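/- For graphs $H$ and $G$ let $\mathcal N(H,G)$ be the number of (not necessarily induced) subgraphs of $G$ isomorphic to $H$. Let $F_2$ be the 2-fan, i.e. two triangles sharing exactly one vertex; a graph is $F$-free if it has no subgraph isomorphic to $F$. Let $\mathrm{ex}(n,H,F)$ be the largest $\mathcal N(H,G)$ over all $F$-free graphs $G$ on $n$ vertices, and let $\mathrm{ex}^{\mathrm{col}}(n,(H_1,\dots,H_k),F)$ be the largest value of $\sum_{i=1}^k\mathcal N(H_i,G_i)$ over all $F$-free graphs $G$ on $n$ vertices and all colorings of the edges of $G$ with the colors $1,\dots,k$, where $G_i$ is the graph formed by the edges of color $i$. **Proposition.** There is an $n_0$ such that for all $n\ge n_0$ $$\mathrm{ex}^{\mathrm{col}}(n,(C_4,K_2),F_2)=\tfrac14\lfloor n/2\rfloor\lceil n/2\rceil(\lfloor n/2\rfloor-1)(\lceil n/2\rceil-1)+1,$$ and this is one more than the monochromatic optimum: $$\mathrm{ex}^{\mathrm{col}}(n,(C_4,K_2),F_2)=\max\{\mathrm{ex}(n,C_4,F_2),\mathrm{ex}(n,K_2,F_2)\}+1.$$ -/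

import Mathlib

namespace ColoredTuran

/-- The 2-fan `F₂`: the triangles `{0, 1, 2}` and `{0, 3, 4}`, which share exactly the vertex `0`. -/
def twoFan : SimpleGraph (Fin 5) :=
  SimpleGraph.fromEdgeSet {s(0, 1), s(0, 2), s(1, 2), s(0, 3), s(0, 4), s(3, 4)}

open scoped Classical in
/-- The generalized Turán number `ex(n, H, F)`: the largest number of subgraphs isomorphic to `H`
in an `F`-free graph on `n` vertices. -/
noncomputable def genEx (n : ℕ) {W U : Type*} (H : SimpleGraph W) (F : SimpleGraph U) : ℕ :=
  Finset.sup {G : SimpleGraph (Fin n) | F.Free G} fun G => G.copyCount H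

/-- `N^col(H₁, …, H_k; G)` for a graph `G` with edge coloring `C`: the sum over the colors `i` of
the number of copies of `H i` in the graph formed by the edges of color `i`. The graph `H i` is
given as a graph on the vertex set `Fin m` for some `m`. -/
noncomputable def colCount {V : Type*} [Fintype V] {k : ℕ} (H : Fin k → Σ m, SimpleGraph (Fin m))
    {G : SimpleGraph V} (C : G.EdgeLabeling (Fin k)) : ℕ :=
  ∑ i, (C.labelGraph i).copyCount (H i).2

open scoped Classical in
/-- `ex^col(n, (H₁, …, H_k), F)`: the largest `N^col(H₁, …, H_k; G)` over all `F`-free graphs `G`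
on `n` vertices and all colorings of the edges of `G` with `k` colors. -/
noncomputable def colEx (n : ℕ) {U : Type*} {k : ℕ} (H : Fin k → Σ m, SimpleGraph (Fin m))
    (F : SimpleGraph U) : ℕ :=
  Finset.sup {G : SimpleGraph (Fin n) | F.Free G} fun G =>
    Finset.univ.sup fun C : G.EdgeLabeling (Fin k) => colCount H C

end ColoredTuran

/-! Write q = `turanTwo n` for the number of edges of the balanced complete bipartite graph and M =
`turanTwo (n - 2)` for the number of 4-cycles through each of its edges.

In an F₂-free graph on at least 6 vertices no edge lies in more than M 4-cycles
(`FanFree.card_cyclePairs_le`): up to small exceptions, the pairs completing uv to a 4-cycle lie in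
X × Y for disjoint sets X, Y avoiding u and v. Double counting gives 4·N(C₄) ≤ e(G)·M, so N(C₄) ≤
qM/4 whenever e(G) ≤ q.

An F₂-free graph on n ≥ 200 vertices with more than q edges has exactly q + 1, and one of them lies
in no 4-cycle (`FanFree.exists_cyclePairs_eq_empty`), so again N(C₄) ≤ qM/4. Its proof deletes a few
vertices and compares the loss of edges with the growth of `turanTwo`: this forces every triangle to
contain a heavy edge, any two triangles to meet, and a heavy edge uv to lie in no 4-cycle. All
triangles then contain uv, and Mantel's theorem applies to G - uv.

In a colored graph, k + 1 ≥ 1 edges of the second color leave at most q - k of the first, so the sum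
is at most (q - k)M/4 + k + 1 ≤ qM/4 + 1 because M ≥ 4. Adding one edge of the second color inside a
part of the bipartite graph attains this. -/

namespace ColoredTuran
open SimpleGraph Finset

/-! ### Counting copies through labelled copies and through edges. -/

/-- Every unlabelled copy of `H` carries as many labellings as `H` has automorphisms. -/
theorem copyCount_mul_card_aut {V W : Type*} [Fintype V] (G : SimpleGraph V) (H : SimpleGraph W) :
    G.copyCount H * Nat.card (H ≃g H) = Nat.card (Copy H G) := by
  classical
  have h1 : G.copyCount H = Nat.card {S : G.Subgraph // Nonempty (H ≃g S.coe)} := by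
    rw [copyCount, Nat.card_eq_fintype_card, Fintype.card_subtype]
  rw [h1, ← Nat.card_prod]
  have hmap : ∀ (S : G.Subgraph) (e : H ≃g S.coe),
      Subgraph.map (S.hom.comp e.toHom) ⊤ = S := by
    intro S e
    simp [Subgraph.map_comp]
  -- With one isomorphism `H ≃g S.coe` fixed per image `S`, the other labelled copies with that
  -- image differ from it by an automorphism of `H`.
  let F : {S : G.Subgraph // Nonempty (H ≃g S.coe)} × (H ≃g H) → Copy H G := fun p =>
    p.1.1.coeCopy.comp (Iso.toCopy (p.2.trans p.1.2.some))
  have hF : ∀ p a, F p a = (p.1.2.some (p.2 a)).1 := fun p a => rfl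
  have hFS : ∀ p, (F p).toSubgraph = p.1.1 := fun p => hmap p.1.1 (p.2.trans p.1.2.some)
  refine Nat.card_congr (Equiv.ofBijective F ⟨?_, ?_⟩)
  · rintro ⟨S, σ⟩ ⟨T, τ⟩ h
    have hST : S = T := by
      apply Subtype.ext
      rw [← hFS (S, σ), h, hFS]
    subst hST
    congr 1
    ext a
    have := DFunLike.congr_fun h a
    rw [hF, hF] at this
    exact S.2.some.injective (Subtype.ext this)
  · intro f
    have key : ∀ S, f.toSubgraph = S → ∃ e : H ≃g S.coe, ∀ a, (e a).1 = f a := by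
      rintro _ rfl
      exact ⟨f.isoToSubgraph, fun a => rfl⟩
    obtain ⟨e, he⟩ := key _ rfl
    have hS : Nonempty (H ≃g f.toSubgraph.coe) := ⟨e⟩
    refine ⟨(⟨f.toSubgraph, hS⟩, e.trans hS.some.symm), ?_⟩
    ext a
    rw [hF, ← he]
    simp

/-- Non-adjacency of distinct vertices in the 4-cycle is the antipodal matching `i ↔ i + 2`, so
automorphisms are the permutations commuting with `i ↦ i + 2`, which can be enumerated. -/
theorem card_aut_cycleGraph_four : Nat.card (cycleGraph 4 ≃g cycleGraph 4) = 8 := by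
  have e : (cycleGraph 4 ≃g cycleGraph 4) ≃
      {σ : Equiv.Perm (Fin 4) // ∀ i, σ (i + 2) = σ i + 2} :=
    { toFun := fun f => ⟨f.toEquiv, by
        intro i
        have hm := fun a b => f.map_rel_iff (a := a) (b := b)
        have key : ∀ g : Equiv.Perm (Fin 4), (∀ a b, (cycleGraph 4).Adj (g a) (g b) ↔
            (cycleGraph 4).Adj a b) → ∀ i, g (i + 2) = g i + 2 := by decide
        exact key f.toEquiv hm i⟩
      invFun := fun g => ⟨g.1, by
        have key : ∀ g : Equiv.Perm (Fin 4), (∀ i, g (i + 2) = g i + 2) → 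
           ∀ a b, (cycleGraph 4).Adj (g a) (g b) ↔ (cycleGraph 4).Adj a b := by decide
        exact fun {a b} => key g.1 g.2 a b⟩
      left_inv := fun f => rfl
      right_inv := fun g => rfl }
  rw [Nat.card_congr e, Nat.card_eq_fintype_card]
  decide

theorem card_aut_completeGraph_two :
    Nat.card (completeGraph (Fin 2) ≃g completeGraph (Fin 2)) = 2 := by
  have e : (completeGraph (Fin 2) ≃g completeGraph (Fin 2)) ≃ Equiv.Perm (Fin 2) :=
    { toFun := fun f => f.toEquiv
      invFun := fun g => ⟨g, by simp⟩
      left_inv := fun f => rfl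
      right_inv := fun g => rfl }
  rw [Nat.card_congr e, Nat.card_eq_fintype_card]
  decide

/-- The pairs `(x, y)` completing the edge `uv` to a 4-cycle `u v x y`. -/
def cyclePairs {V : Type*} [Fintype V] [DecidableEq V] (G : SimpleGraph V) [DecidableRel G.Adj]
    (u v : V) : Finset (V × V) :=
  {p | G.Adj v p.1 ∧ G.Adj p.1 p.2 ∧ G.Adj p.2 u ∧ p.1 ≠ u ∧ p.2 ≠ v}


/-- A labelled 4-cycle is an oriented edge with a completing pair, and each cycle has 8 labellings.
-/
theorem eight_mul_copyCount_cycleGraph_four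
    {V : Type*} [Fintype V] [DecidableEq V] (G : SimpleGraph V) [DecidableRel G.Adj] :
    8 * G.copyCount (cycleGraph 4) =
      ∑ u, ∑ v, if G.Adj u v then #(cyclePairs G u v) else 0 := by
  have h := copyCount_mul_card_aut G (cycleGraph 4)
  rw [card_aut_cycleGraph_four] at h
  rw [mul_comm, h]
  have e : Copy (cycleGraph 4) G ≃ {p : (V × V) × (V × V) //
      G.Adj p.1.1 p.1.2 ∧ p.2 ∈ cyclePairs G p.1.1 p.1.2} :=
    { toFun := fun f => ⟨((f 0, f 1), (f 2, f 3)), by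
        have hadj : ∀ i j, (cycleGraph 4).Adj i j → G.Adj (f i) (f j) :=
          fun i j hij => f.toHom.map_adj hij
        have hinj : ∀ i j, i ≠ j → f i ≠ f j := fun i j hij h => hij (f.injective h)
        refine ⟨hadj 0 1 (by decide), ?_⟩
        simp only [cyclePairs, mem_filter, mem_univ, true_and]
        exact ⟨hadj 1 2 (by decide), hadj 2 3 (by decide), hadj 3 0 (by decide),
          hinj 2 0 (by decide), hinj 3 1 (by decide)⟩⟩
      invFun := fun p => ⟨⟨![p.1.1.1, p.1.1.2, p.1.2.1, p.1.2.2], by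
        obtain ⟨⟨⟨a, b⟩, ⟨c, d⟩⟩, h1, h2⟩ := p
        simp only [cyclePairs, mem_filter, mem_univ, true_and] at h1 h2
        obtain ⟨h2, h3, h4, h5, h6⟩ := h2
        intro i j hij
        have hc : (i = 0 ∧ j = 1) ∨ (i = 1 ∧ j = 2) ∨ (i = 2 ∧ j = 3) ∨ (i = 3 ∧ j = 0) ∨
           (j = 0 ∧ i = 1) ∨ (j = 1 ∧ i = 2) ∨ (j = 2 ∧ i = 3) ∨ (j = 3 ∧ i = 0) := by
          revert i j; decide
        rcases hc with ⟨rfl, rfl⟩ | ⟨rfl, rfl⟩ | ⟨rfl, rfl⟩ | ⟨rfl, rfl⟩ | ⟨rfl, rfl⟩ |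
          ⟨rfl, rfl⟩ | ⟨rfl, rfl⟩ | ⟨rfl, rfl⟩
        exacts [h1, h2, h3, h4, h1.symm, h2.symm, h3.symm, h4.symm]⟩, by
        obtain ⟨⟨⟨a, b⟩, ⟨c, d⟩⟩, h1, h2⟩ := p
        simp only [cyclePairs, mem_filter, mem_univ, true_and] at h1 h2
        obtain ⟨h2, h3, h4, h5, h6⟩ := h2
        have e1 := h1.ne
        have e2 := h2.ne
        have e3 := h3.ne
        have e4 := h4.ne
        intro i j hij
        change ![a, b, c, d] i = ![a, b, c, d] j at hij
        fin_cases i <;> fin_cases j <;> simp_all [eq_comm]⟩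
      left_inv := fun f => by
        ext i
        fin_cases i <;> rfl
      right_inv := fun p => rfl }
  rw [Nat.card_congr e, Nat.card_eq_fintype_card, Fintype.card_subtype, ← sum_product',
    card_filter, Fintype.sum_prod_type]
  refine Finset.sum_congr rfl fun p _ => ?_
  by_cases hp : G.Adj p.1 p.2
  · simp [hp]
  · simp [hp]

/-- The number of ordered pairs of adjacent vertices in `A × B`. -/
def adjPairs {V : Type*} (G : SimpleGraph V) [DecidableRel G.Adj]
    (A B : Finset V) : ℕ := ∑ x ∈ A, ∑ y ∈ B, if G.Adj x y then 1 else 0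

theorem adjPairs_comm {V : Type*} (G : SimpleGraph V) [DecidableRel G.Adj]
    (A B : Finset V) : adjPairs G A B = adjPairs G B A := by
  rw [adjPairs, adjPairs, sum_comm]
  simp [G.adj_comm]

theorem two_mul_copyCount_completeGraph_two {V : Type*} [Fintype V]
    (G : SimpleGraph V) [DecidableRel G.Adj] :
    2 * G.copyCount (completeGraph (Fin 2)) = adjPairs G univ univ := by
  have h := copyCount_mul_card_aut G (completeGraph (Fin 2))
  rw [card_aut_completeGraph_two] at h
  rw [mul_comm, h]
  have e : Copy (completeGraph (Fin 2)) G ≃ {p : V × V // G.Adj p.1 p.2} :=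
    { toFun := fun f => ⟨(f 0, f 1), f.toHom.map_adj (by simp)⟩
      invFun := fun p => ⟨⟨![p.1.1, p.1.2], by
        obtain ⟨⟨a, b⟩, h⟩ := p
        intro i j hij
        fin_cases i <;> fin_cases j <;> simp_all [G.adj_comm]⟩, by
        obtain ⟨⟨a, b⟩, h⟩ := p
        have := h.ne
        intro i j hij
        change ![a, b] i = ![a, b] j at hij
        fin_cases i <;> fin_cases j <;> simp_all [eq_comm]⟩
      left_inv := fun f => by
        ext i
        fin_cases i <;> rfl
      right_inv := fun p => rfl }
  rw [Nat.card_congr e, Nat.card_eq_fintype_card, Fintype.card_subtype, adjPairs, ← sum_product',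
    card_filter]
  rfl

/-! ### F₂-freeness as a condition on pairs of triangles. -/

/-- No two triangles share exactly one vertex. -/
def FanFree {V : Type*} (G : SimpleGraph V) : Prop :=
  ∀ c a b d e, G.Adj c a → G.Adj c b → G.Adj a b → G.Adj c d → G.Adj c e → G.Adj d e →
    a = d ∨ a = e ∨ b = d ∨ b = e

theorem FanFree.of_free {V : Type*} {G : SimpleGraph V} (h : twoFan.Free G) : FanFree G := by
  intro c a b d e h1 h2 h3 h4 h5 h6
  by_contra hne
  push Not at hne
  obtain ⟨n1, n2, n3, n4⟩ := hne
  refine h ⟨⟨⟨![c, a, b, d, e], ?_⟩, ?_⟩⟩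
  · intro i j hij
    rw [twoFan, fromEdgeSet_adj] at hij
    fin_cases i <;> fin_cases j <;> simp_all [G.adj_comm]
  · have e1 := h1.ne
    have e2 := h2.ne
    have e3 := h3.ne
    have e4 := h4.ne
    have e5 := h5.ne
    have e6 := h6.ne
    intro i j hij
    change ![c, a, b, d, e] i = ![c, a, b, d, e] j at hij
    fin_cases i <;> fin_cases j <;> simp_all [eq_comm]

theorem free_of_fanFree {V : Type*} {G : SimpleGraph V} (h : FanFree G) : twoFan.Free G := by
  rintro ⟨f⟩
  have hadj : ∀ i j, i ≠ j → s(i, j) ∈ ({s(0, 1), s(0, 2), s(1, 2), s(0, 3), s(0, 4), s(3, 4)} :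
      Set (Sym2 (Fin 5))) → G.Adj (f i) (f j) := fun i j hne hm =>
    f.toHom.map_adj ((fromEdgeSet_adj _).2 ⟨hm, hne⟩)
  have := h (f 0) (f 1) (f 2) (f 3) (f 4) (hadj _ _ (by decide) (by simp))
    (hadj _ _ (by decide) (by simp)) (hadj _ _ (by decide) (by simp))
    (hadj _ _ (by decide) (by simp)) (hadj _ _ (by decide) (by simp))
    (hadj _ _ (by decide) (by simp))
  have hinj : ∀ i j, i ≠ j → f i ≠ f j := fun i j hij h => hij (f.injective h)
  rcases this with h | h | h | h
  exacts [hinj 1 3 (by decide) h, hinj 1 4 (by decide) h, hinj 2 3 (by decide) h,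
    hinj 2 4 (by decide) h]

/-! ### Bipartite edge numbers, Mantel's theorem and a crude edge bound. -/

/-- The number of edges of the balanced complete bipartite graph on `n` vertices. -/
def turanTwo (n : ℕ) : ℕ := n / 2 * ((n + 1) / 2)

theorem turanTwo_succ (n : ℕ) : turanTwo (n + 1) = turanTwo n + (n + 1) / 2 := by
  unfold turanTwo
  have : (n + 1 + 1) / 2 = n / 2 + 1 := by omega
  rw [this]
  ring

theorem turanTwo_add_two (n : ℕ) : turanTwo (n + 2) = turanTwo n + n + 1 := by
  rw [turanTwo_succ, turanTwo_succ]
  omega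

theorem mul_le_turanTwo {a b n : ℕ} (h : a + b ≤ n) : a * b ≤ turanTwo n := by
  induction n using Nat.strong_induction_on generalizing a b with
  | _ n ih =>
    rcases Nat.eq_zero_or_pos a with rfl | ha
    · simp
    rcases Nat.eq_zero_or_pos b with rfl | hb
    · simp
    obtain ⟨m, rfl⟩ : ∃ m, n = m + 2 := ⟨n - 2, by omega⟩
    obtain ⟨a, rfl⟩ : ∃ a', a = a' + 1 := ⟨a - 1, by omega⟩
    obtain ⟨b, rfl⟩ : ∃ b', b = b' + 1 := ⟨b - 1, by omega⟩
    have := ih m (by omega) (a := a) (b := b) (by omega)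
    rw [turanTwo_add_two]
    nlinarith

theorem adjPairs_eq_sum_card {V : Type*} (G : SimpleGraph V) [DecidableRel G.Adj]
    (A B : Finset V) :
    adjPairs G A B = ∑ x ∈ A, #{y ∈ B | G.Adj x y} := by
  unfold adjPairs
  simp only [card_filter]

theorem adjPairs_self_le {V : Type*} {G : SimpleGraph V} [DecidableRel G.Adj]
    (S : Finset V) : adjPairs G S S ≤ #S * #S := by
  rw [adjPairs_eq_sum_card, ← smul_eq_mul]
  exact sum_le_card_nsmul _ _ _ fun x _ => card_filter_le _ _

section

variable {V : Type*} [DecidableEq V] (G : SimpleGraph V) [DecidableRel G.Adj]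

theorem adjPairs_sdiff {S U : Finset V} (h : S ⊆ U) :
    adjPairs G U U = adjPairs G (U \ S) (U \ S) + 2 * adjPairs G (U \ S) S + adjPairs G S S := by
  have h1 : ∀ A, adjPairs G U A = adjPairs G (U \ S) A + adjPairs G S A := fun A => by
    rw [adjPairs, ← sum_sdiff h]
    rfl
  rw [h1, adjPairs_comm G (U \ S) U, adjPairs_comm G S U, h1, h1, adjPairs_comm G S (U \ S)]
  ring

variable {G}

/-- The deletion step behind the edge bounds: `k` and `d` are chosen so that the loss can be
compared with the growth of `turanTwo`. -/
theorem adjPairs_le_of_card_le {S U : Finset V} (h : S ⊆ U) {k d : ℕ}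
    (hk : ∀ z ∈ U \ S, #{y ∈ S | G.Adj z y} ≤ k) (hd : adjPairs G S S ≤ d) :
    adjPairs G U U ≤ adjPairs G (U \ S) (U \ S) + 2 * (k * #(U \ S)) + d := by
  have : adjPairs G (U \ S) S ≤ k * #(U \ S) := by
    rw [adjPairs_eq_sum_card, mul_comm, ← smul_eq_mul]
    exact sum_le_card_nsmul _ _ _ hk
  rw [adjPairs_sdiff G h]
  omega

theorem adjPairs_self_le' (S : Finset V) : adjPairs G S S ≤ #S * (#S - 1) := by
  rw [adjPairs_eq_sum_card, ← smul_eq_mul]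
  refine sum_le_card_nsmul _ _ _ fun x hx => ?_
  rw [← card_erase_of_mem hx]
  refine card_le_card fun y hy => ?_
  rw [mem_filter] at hy
  exact mem_erase.2 ⟨hy.2.ne', hy.1⟩

/-- Mantel's theorem inside a vertex set. -/
theorem adjPairs_le_of_triangleFree (U : Finset V)
    (h : ∀ x ∈ U, ∀ y ∈ U, ∀ z ∈ U, G.Adj x y → G.Adj y z → ¬ G.Adj z x) :
    adjPairs G U U ≤ 2 * turanTwo #U := by
  induction hs : #U using Nat.strong_induction_on generalizing U with
  | _ s ih =>
    by_cases hE : ∃ u ∈ U, ∃ v ∈ U, G.Adj u v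
    · obtain ⟨u, hu, v, hv, huv⟩ := hE
      have hS : {u, v} ⊆ U := by
        intro x hx
        simp only [mem_insert, mem_singleton] at hx
        rcases hx with rfl | rfl <;> assumption
      have hc : #({u, v} : Finset V) = 2 := card_pair huv.ne
      have hcU := card_sdiff_add_card_eq_card hS
      rw [hc, hs] at hcU
      -- Without triangles, another vertex sees at most one end of `uv`; `d = 2` is this edge in
      -- both orders.
      have hle := adjPairs_le_of_card_le (G := G) hS (k := 1) (d := 2) ?_ ?_
      · have := ih #(U \ {u, v}) (by omega) (U \ {u, v})
          (fun x hx y hy z hz => h x (sdiff_subset hx) y (sdiff_subset hy) z (sdiff_subset hz)) rfl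
        have e : s = #(U \ {u, v}) + 2 := hcU.symm
        rw [e, turanTwo_add_two]
        omega
      · intro z hz
        rw [mem_sdiff] at hz
        rw [card_le_one]
        intro a ha b hb
        simp only [mem_filter, mem_insert, mem_singleton] at ha hb
        obtain ⟨rfl | rfl, ha⟩ := ha <;> obtain ⟨rfl | rfl, hb⟩ := hb
        · rfl
        · exact absurd ha (h _ hu _ hv _ hz.1 huv hb.symm)
        · exact absurd hb (h _ hu _ hv _ hz.1 huv ha.symm)
        · rfl
      · have := adjPairs_self_le' (G := G) {u, v}
        rwa [hc] at this
    · push Not at hE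
      have : adjPairs G U U = 0 := by
        rw [adjPairs]
        exact sum_eq_zero fun x hx => sum_eq_zero fun y hy => if_neg (hE x hx y hy)
      omega

/-- If all degrees in `U` exceed half, every edge lies in a triangle inside `U` and all degrees are
at least 4. Fan-freeness then makes triangles at a vertex overlap until some edge has two common
neighbors, which `key` excludes. -/
theorem FanFree.exists_small_degree (hF : FanFree G) {U : Finset V} (hU : 6 ≤ #U) :
    ∃ x ∈ U, #{y ∈ U | G.Adj x y} ≤ #U / 2 := by
  by_contra hcon
  push Not at hcon
  have hcommon : ∀ x ∈ U, ∀ y ∈ U, G.Adj x y → ∃ z ∈ U, G.Adj x z ∧ G.Adj y z := by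
    intro x hx y hy hxy
    have h1 := hcon x hx
    have h2 := hcon y hy
    have h3 := card_union_add_card_inter {z ∈ U | G.Adj x z} {z ∈ U | G.Adj y z}
    have h4 : #({z ∈ U | G.Adj x z} ∪ {z ∈ U | G.Adj y z}) ≤ #U :=
      card_le_card (union_subset (filter_subset _ _) (filter_subset _ _))
    have h5 : 0 < #({z ∈ U | G.Adj x z} ∩ {z ∈ U | G.Adj y z}) := by omega
    obtain ⟨z, hz⟩ := card_pos.1 h5
    simp only [mem_inter, mem_filter] at hz
    exact ⟨z, hz.1.1, hz.1.2, hz.2.2⟩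
  have hdeg : ∀ x ∈ U, ∀ T : Finset V, #T ≤ 3 → ∃ r ∈ U, G.Adj x r ∧ r ∉ T := by
    intro x hx T hT
    have := hcon x hx
    obtain ⟨r, hr, hrT⟩ := exists_mem_notMem_of_card_lt_card
      (s := T) (t := {y ∈ U | G.Adj x y}) (by omega)
    rw [mem_filter] at hr
    exact ⟨r, hr.1, hr.2, hrT⟩
  -- A further neighbor `r` of `w` gives a triangle on `wr` that must meet `{x, y}`; at the vertex
  -- where it does, it forms a fan with the triangle `xyp`.
  have key : ∀ x ∈ U, ∀ y ∈ U, ∀ w ∈ U, ∀ p ∈ U, G.Adj x y → G.Adj x w → G.Adj y w → G.Adj x p →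
      G.Adj y p → p ≠ w → False := by
    intro x hx y hy w hw p hp hxy hxw hyw hxp hyp hpw
    obtain ⟨r, hr, hwr, hrT⟩ := hdeg w hw {x, y, p} card_le_three
    simp only [mem_insert, mem_singleton, not_or] at hrT
    obtain ⟨hrx, hry, hrp⟩ := hrT
    obtain ⟨z, hz, hwz, hrz⟩ := hcommon w hw r hr hwr
    have h1 := hF w x y r z hxw.symm hyw.symm hxy hwr hwz hrz
    have n1 := hxy.ne
    have n2 := hyw.ne
    have n3 := hxw.ne
    rcases h1 with h1 | rfl | h1 | rfl
    · exact hrx h1.symm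
    · rcases hF x w r y p hxw hrz.symm hwr hxy hxp hyp with h | h | h | h
      exacts [n2 h.symm, hpw h.symm, hry h, hrp h]
    · exact hry h1.symm
    · rcases hF y w r x p hyw hrz.symm hwr hxy.symm hyp hxp with h | h | h | h
      exacts [n3 h.symm, hpw h.symm, hrx h, hrp h]
  have hne : U.Nonempty := card_pos.1 (by omega)
  obtain ⟨x, hx⟩ := hne
  obtain ⟨y, hy, hxy, -⟩ := hdeg x hx ∅ (by simp)
  obtain ⟨w, hw, hxw, hyw⟩ := hcommon x hx y hy hxy
  obtain ⟨p, hp, hxp, hpT⟩ := hdeg x hx {y, w} (card_le_two.trans (by norm_num))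
  simp only [mem_insert, mem_singleton, not_or] at hpT
  obtain ⟨hpy, hpw⟩ := hpT
  obtain ⟨z, hz, hxz, hpz⟩ := hcommon x hx p hp hxp
  rcases hF x y w p z hxy hxw hyw hxp hxz hpz with h | rfl | h | rfl
  · exact hpy h.symm
  · exact key x hx y hy w hw p hp hxy hxw hyw hxp hpz.symm hpw
  · exact hpw h.symm
  · exact key x hx w hw y hy p hp hxw hxy hyw.symm hxp hpz.symm hpy

/-- A crude bound on the number of edges, without a lower bound on the number of vertices. -/
theorem FanFree.adjPairs_le (hF : FanFree G) (U : Finset V) :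
    adjPairs G U U ≤ 2 * turanTwo #U + 8 := by
  induction hs : #U generalizing U with
  | zero =>
    rw [card_eq_zero] at hs
    simp [hs, adjPairs]
  | succ s ih =>
    by_cases h6 : 6 ≤ s + 1
    · obtain ⟨x, hx, hd⟩ := hF.exists_small_degree (hs ▸ h6)
      have hsub : {x} ⊆ U := singleton_subset_iff.2 hx
      have hcU := card_sdiff_add_card_eq_card hsub
      rw [card_singleton, hs] at hcU
      have h1 := adjPairs_sdiff G hsub
      have h2 : adjPairs G {x} {x} = 0 := by simp [adjPairs]
      have h3 : adjPairs G (U \ {x}) {x} ≤ #{y ∈ U | G.Adj x y} := by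
        rw [adjPairs_comm, adjPairs_eq_sum_card, sum_singleton]
        exact card_le_card (filter_subset_filter _ sdiff_subset)
      have h4 := ih (U \ {x}) (by omega)
      rw [turanTwo_succ]
      omega
    -- For at most five vertices all pairs are counted; 5 · 4 = 2 · 6 + 8 dictates the constant 8.
    · have h1 := adjPairs_self_le' (G := G) U
      rw [hs] at h1
      have : s ≤ 4 := by omega
      interval_cases s <;> simp [turanTwo] at h1 ⊢ <;> omega

end

/-! ### Products of disjoint sets; heavy edges and spanned triangles. -/

theorem card_le_turanTwo_of_subset_product {V : Type*} [DecidableEq V]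
    {P : Finset (V × V)} {X Y W : Finset V}
    (hP : P ⊆ X ×ˢ Y) (hX : X ⊆ W) (hY : Y ⊆ W) (h : Disjoint X Y) : #P ≤ turanTwo #W := by
  refine (card_le_card hP).trans ?_
  rw [card_product]
  apply mul_le_turanTwo
  rw [← card_union_of_disjoint h]
  exact card_le_card (union_subset hX hY)

theorem card_filter_union_le {V : Type*} [DecidableEq V] {G : SimpleGraph V}
    [DecidableRel G.Adj] (S T : Finset V) (z : V) :
    #{y ∈ S ∪ T | G.Adj z y} ≤ #{y ∈ S | G.Adj z y} + #{y ∈ T | G.Adj z y} := by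
  rw [filter_union]
  exact card_union_le _ _

/-- An edge with at least three common neighbors. -/
def IsHeavy {V : Type*} [Fintype V] (G : SimpleGraph V) [DecidableRel G.Adj] (u v : V) : Prop :=
  G.Adj u v ∧ 3 ≤ #{z | G.Adj u z ∧ G.Adj v z}

theorem IsHeavy.symm {V : Type*} [Fintype V] {G : SimpleGraph V} [DecidableRel G.Adj] {u v : V}
    (h : IsHeavy G u v) : IsHeavy G v u :=
  ⟨h.1.symm, by simpa only [and_comm] using h.2⟩

theorem adjPairs_le_deleteEdges_add_two {V : Type*} [Fintype V] [DecidableEq V]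
    (G : SimpleGraph V) [DecidableRel G.Adj] (u v : V) :
    adjPairs G univ univ ≤ adjPairs (G.deleteEdges {s(u, v)}) univ univ + 2 := by
  have : ∀ a b, (if G.Adj a b then 1 else 0) ≤
      (if (G.deleteEdges {s(u, v)}).Adj a b then 1 else 0) +
        ((if a = u then if b = v then 1 else 0 else 0) +
          (if a = v then if b = u then 1 else 0 else 0)) := by
    intro a b
    by_cases h : G.Adj a b
    · by_cases h' : s(a, b) = s(u, v)
      · rcases Sym2.eq_iff.1 h' with ⟨rfl, rfl⟩ | ⟨rfl, rfl⟩
        · simp [h]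
        · simp [h]
      · rw [if_pos h, if_pos (deleteEdges_adj.2 ⟨h, h'⟩)]
        exact Nat.le_add_right _ _
    · rw [if_neg h]
      exact Nat.zero_le _
  refine (sum_le_sum fun a _ => sum_le_sum fun b _ => this a b).trans ?_
  simp only [sum_add_distrib]
  simp [adjPairs]

/-- The vertex `z` forms a triangle with two vertices of `S`. -/
def SpansTriangle {V : Type*} (G : SimpleGraph V) (z : V) (S : Finset V) : Prop :=
  ∃ x ∈ S, ∃ y ∈ S, G.Adj z x ∧ G.Adj z y ∧ G.Adj x y

theorem FanFree.not_spansTriangle {V : Type*} {G : SimpleGraph V}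
    (hF : FanFree G) {S T : Finset V} (hST : Disjoint S T) {z : V}
    (hS : SpansTriangle G z S) : ¬ SpansTriangle G z T := by
  rintro ⟨a, ha, b, hb, h1, h2, h3⟩
  obtain ⟨c, hc, d, hd, h4, h5, h6⟩ := hS
  rw [Finset.disjoint_left] at hST
  rcases hF z a b c d h1 h2 h3 h4 h5 h6 with rfl | rfl | rfl | rfl
  exacts [hST hc ha, hST hd ha, hST hc hb, hST hd hb]

/-! ### Four-cycles through a given edge. -/

section

variable {V : Type*} [Fintype V] [DecidableEq V] {G : SimpleGraph V} [DecidableRel G.Adj]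

theorem card_sdiff_univ (S : Finset V) : #(univ \ S) = Fintype.card V - #S := by
  rw [card_sdiff_of_subset (subset_univ _), card_univ]

theorem card_cyclePairs_comm (u v : V) : #(cyclePairs G u v) = #(cyclePairs G v u) := by
  refine card_bij' (fun p _ => p.swap) (fun p _ => p.swap) ?_ ?_ (by simp) (by simp) <;>
  · rintro ⟨x, y⟩ h
    simp only [cyclePairs, mem_filter, mem_univ, true_and, Prod.swap] at h ⊢
    exact ⟨h.2.2.1.symm, h.2.1.symm, h.1.symm, h.2.2.2.2, h.2.2.2.1⟩

/-- The case where `uv` and `u x₀` are edges of overlapping triangles. If `v` is adjacent to `y₀`,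
the four vertices form a K₄: at most two completing pairs lie inside it, and the others avoid it and
lie in `X × Y`. Otherwise `x₀` is the only common neighbor of `u` and `v`, and it can be added to
`X`. -/
theorem FanFree.card_cyclePairs_le_of_mem (hF : FanFree G) (hV : 6 ≤ Fintype.card V) {u v : V}
    (huv : G.Adj u v) {x₀ y₀ : V} (h₀ : (x₀, y₀) ∈ cyclePairs G u v) (hux : G.Adj u x₀) :
    #(cyclePairs G u v) ≤ turanTwo (Fintype.card V - 2) := by
  have hmem : ∀ x y, (x, y) ∈ cyclePairs G u v ↔
      G.Adj v x ∧ G.Adj x y ∧ G.Adj y u ∧ x ≠ u ∧ y ≠ v := by simp [cyclePairs]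
  rw [hmem] at h₀
  obtain ⟨hvx, hxy, hyu, hxu, hyv⟩ := h₀
  have n1 := huv.ne
  have n2 := hvx.ne
  have n3 := hxy.ne
  have n4 := hyu.ne
  set X : Finset V := {x | G.Adj v x ∧ x ≠ u ∧ ¬ G.Adj u x} with hX
  set Y : Finset V := {y | G.Adj u y ∧ y ≠ v ∧ ¬ G.Adj v y} with hY
  by_cases hvy : G.Adj v y₀
  · have hT : ∀ t, G.Adj u t → G.Adj v t → t = x₀ ∨ t = y₀ := by
      intro t h1 h2
      rcases hF u v t x₀ y₀ huv h1 h2 hux hyu.symm hxy with h | h | h | h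
      exacts [absurd h n2, absurd h hyv.symm, .inl h, .inr h]
    have hcard : #({u, v, x₀, y₀} : Finset V) = 4 := by
      rw [card_insert_of_notMem (by simp [n1, hxu.symm, n4.symm]),
        card_insert_of_notMem (by simp [n2, hyv.symm]), card_pair n3]
    have hsub : cyclePairs G u v ⊆
        {p ∈ cyclePairs G u v | p ∈ X ×ˢ Y} ∪ {(x₀, y₀), (y₀, x₀)} := by
      rintro ⟨x, y⟩ h
      rw [mem_union, mem_filter]
      by_cases hp : (x, y) ∈ X ×ˢ Y
      · exact .inl ⟨h, hp⟩
      right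
      rw [hmem] at h
      obtain ⟨h1, h2, h3, h4, h5⟩ := h
      have n5 := h2.ne
      simp only [hX, hY, mem_product, mem_filter, mem_univ, true_and, not_and_or, not_not] at hp
      simp only [mem_insert, mem_singleton, Prod.mk.injEq]
      rcases hp with (hp | hp | hp) | (hp | hp | hp)
      · exact absurd h1 hp
      · exact absurd hp h4
      · rcases hT x hp h1 with rfl | rfl
        · rcases hF u x y v y₀ hp h3.symm h2 huv hyu.symm hvy with h | h | h | h
          exacts [absurd h n2.symm, absurd h n3, absurd h h5, .inl ⟨rfl, h⟩]
        · rcases hF u x y v x₀ hp h3.symm h2 huv hux hvx with h | h | h | h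
          exacts [absurd h hyv, absurd h n3.symm, absurd h h5, .inr ⟨rfl, h⟩]
      · exact absurd h3.symm hp
      · exact absurd hp h5
      · rcases hT y h3.symm hp with rfl | rfl
        · rcases hF v x y u y₀ h1 hp h2 huv.symm hvy hyu.symm with h | h | h | h
          exacts [absurd h h4, .inr ⟨h, rfl⟩, absurd h hxu, absurd h n3]
        · rcases hF v x y u x₀ h1 hp h2 huv.symm hvx hux with h | h | h | h
          exacts [absurd h h4, .inl ⟨h, rfl⟩, absurd h n4, absurd h n3.symm]
    have h1 : #{p ∈ cyclePairs G u v | p ∈ X ×ˢ Y} ≤ turanTwo #(univ \ {u, v, x₀, y₀}) := by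
      refine card_le_turanTwo_of_subset_product (X := X) (Y := Y) (fun p hp => (mem_filter.1 hp).2)
        ?_ ?_ ?_
      · intro x hx
        simp only [hX, mem_filter, mem_univ, true_and] at hx
        simp only [mem_sdiff, mem_univ, mem_insert, mem_singleton, true_and, not_or]
        refine ⟨hx.2.1, hx.1.ne', ?_, ?_⟩
        · rintro rfl; exact hx.2.2 hux
        · rintro rfl; exact hx.2.2 hyu.symm
      · intro x hx
        simp only [hY, mem_filter, mem_univ, true_and] at hx
        simp only [mem_sdiff, mem_univ, mem_insert, mem_singleton, true_and, not_or]
        refine ⟨hx.1.ne', hx.2.1, ?_, ?_⟩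
        · rintro rfl; exact hx.2.2 hvx
        · rintro rfl; exact hx.2.2 hvy
      · rw [Finset.disjoint_left]
        intro x hx hy
        simp only [hX, hY, mem_filter] at hx hy
        exact hx.2.2.2 hy.2.1
    have h2 := (card_le_card hsub).trans (card_union_le _ _)
    have h3 : #({(x₀, y₀), (y₀, x₀)} : Finset (V × V)) ≤ 2 := card_le_two
    rw [card_sdiff_univ, hcard] at h1
    obtain ⟨m, hm⟩ : ∃ m, Fintype.card V - 2 = m + 2 := ⟨Fintype.card V - 4, by omega⟩
    rw [hm, turanTwo_add_two]
    have : Fintype.card V - 4 = m := by omega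
    rw [this] at h1
    omega
  · have hT : ∀ t, G.Adj u t → G.Adj v t → t = x₀ := by
      intro t h1 h2
      rcases hF u v t x₀ y₀ huv h1 h2 hux hyu.symm hxy with h | h | h | h
      exacts [absurd h n2, absurd h hyv.symm, h, absurd (h ▸ h2) hvy]
    have hsub : cyclePairs G u v ⊆ (insert x₀ X) ×ˢ Y := by
      rintro ⟨x, y⟩ h
      rw [hmem] at h
      obtain ⟨h1, h2, h3, h4, h5⟩ := h
      rw [mem_product, mem_insert]
      constructor
      · by_cases hx : G.Adj u x
        · exact .inl (hT x hx h1)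
        · exact .inr (by simp [hX, h1, h4, hx])
      · have hy : ¬ G.Adj v y := by
          intro hy
          obtain rfl := hT y h3.symm hy
          rcases hF y v x u y₀ hvx.symm h2.symm h1 hux.symm hxy hyu.symm with h | h | h | h
          exacts [n1 h.symm, hyv h.symm, h4 h, hvy (h ▸ h1)]
        simp [hY, h3.symm, h5, hy]
    have hc : #(univ \ {u, v} : Finset V) = Fintype.card V - 2 := by
      rw [card_sdiff_univ, card_pair n1]
    rw [← hc]
    refine card_le_turanTwo_of_subset_product hsub ?_ ?_ ?_
    · intro x hx
      simp only [hX, mem_insert, mem_filter, mem_univ, true_and] at hx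
      simp only [mem_sdiff, mem_univ, mem_insert, mem_singleton, true_and, not_or]
      rcases hx with rfl | hx
      · exact ⟨hxu, n2.symm⟩
      · exact ⟨hx.2.1, hx.1.ne'⟩
    · intro x hx
      simp only [hY, mem_filter, mem_univ, true_and] at hx
      simp only [mem_sdiff, mem_univ, mem_insert, mem_singleton, true_and, not_or]
      exact ⟨hx.1.ne', hx.2.1⟩
    · rw [Finset.disjoint_left]
      intro x hx hy
      simp only [hX, hY, mem_insert, mem_filter, mem_univ, true_and] at hx hy
      rcases hx with rfl | hx
      · exact hy.2.2 hvx
      · exact hx.2.2 hy.1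

/-- Every edge of an `F₂`-free graph lies in at most as many 4-cycles as in the Turán graph. -/
theorem FanFree.card_cyclePairs_le (hF : FanFree G) (hV : 6 ≤ Fintype.card V) {u v : V}
    (huv : G.Adj u v) : #(cyclePairs G u v) ≤ turanTwo (Fintype.card V - 2) := by
  by_cases h1 : ∃ p ∈ cyclePairs G u v, G.Adj u p.1
  · obtain ⟨p, hp, h⟩ := h1
    exact hF.card_cyclePairs_le_of_mem hV huv hp h
  by_cases h2 : ∃ p ∈ cyclePairs G v u, G.Adj v p.1
  · obtain ⟨p, hp, h⟩ := h2
    rw [card_cyclePairs_comm]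
    exact hF.card_cyclePairs_le_of_mem hV huv.symm hp h
  push Not at h1 h2
  have hc : #(univ \ {u, v} : Finset V) = Fintype.card V - 2 := by
    rw [card_sdiff_univ, card_pair huv.ne]
  rw [← hc]
  refine card_le_turanTwo_of_subset_product (X := {x | G.Adj v x ∧ x ≠ u ∧ ¬ G.Adj u x})
    (Y := {y | G.Adj u y ∧ y ≠ v ∧ ¬ G.Adj v y}) ?_ ?_ ?_ ?_
  · rintro ⟨x, y⟩ h
    have h3 := h1 _ h
    simp only [cyclePairs, mem_filter, mem_univ, true_and] at h
    have h4 : ¬ G.Adj v y := h2 (y, x) (by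
      simp only [cyclePairs, mem_filter, mem_univ, true_and]
      exact ⟨h.2.2.1.symm, h.2.1.symm, h.1.symm, h.2.2.2.2, h.2.2.2.1⟩)
    simp only [mem_product, mem_filter, mem_univ, true_and]
    exact ⟨⟨h.1, h.2.2.2.1, h3⟩, h.2.2.1.symm, h.2.2.2.2, h4⟩
  · intro x hx
    simp only [mem_filter, mem_univ, true_and] at hx
    simp only [mem_sdiff, mem_univ, mem_insert, mem_singleton, true_and, not_or]
    exact ⟨hx.2.1, hx.1.ne'⟩
  · intro x hx
    simp only [mem_filter, mem_univ, true_and] at hx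
    simp only [mem_sdiff, mem_univ, mem_insert, mem_singleton, true_and, not_or]
    exact ⟨hx.1.ne', hx.2.1⟩
  · rw [Finset.disjoint_left]
    intro x hx hy
    simp only [mem_filter, mem_univ, true_and] at hx hy
    exact hx.2.2 hy.1

/-! ### Structure of graphs with more edges than the bipartite bound. -/

theorem IsHeavy.exists_common {u v : V} (h : IsHeavy G u v) (a b : V) :
    ∃ w, G.Adj u w ∧ G.Adj v w ∧ w ≠ a ∧ w ≠ b := by
  obtain ⟨w, hw, hwT⟩ := exists_mem_notMem_of_card_lt_card
    (s := {a, b}) (t := {z | G.Adj u z ∧ G.Adj v z}) (card_le_two.trans_lt h.2)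
  simp only [mem_filter, mem_univ, true_and] at hw
  simp only [mem_insert, mem_singleton, not_or] at hwT
  exact ⟨w, hw.1, hw.2, hwT⟩

/-- Every triangle at an endpoint of a heavy edge contains that edge. -/
theorem FanFree.eq_or_eq_of_isHeavy (hF : FanFree G) {u v : V} (h : IsHeavy G u v) {a b : V}
    (ha : G.Adj u a) (hb : G.Adj u b) (hab : G.Adj a b) : a = v ∨ b = v := by
  -- Three common neighbors leave one outside `{a, b}`, and `uvw` would form a fan with `uab`.
  obtain ⟨w, h1, h2, h3, h4⟩ := h.exists_common a b
  rcases hF u v w a b h.1 h1 h2 ha hb hab with h | h | h | h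
  exacts [.inl h.symm, .inr h.symm, absurd h h3, absurd h h4]

/-- A vertex with j neighbors in the triangle satisfies j ≤ 1 + C(j, 2). Without heavy edges the
binomials sum to at most 3 · 2 = 6, so deleting the triangle loses too few edges. -/
theorem FanFree.exists_isHeavy (hF : FanFree G) (hV : 60 ≤ Fintype.card V)
    (hD : 2 * turanTwo (Fintype.card V) < adjPairs G univ univ) {u v w : V}
    (huv : G.Adj u v) (huw : G.Adj u w) (hvw : G.Adj v w) :
    IsHeavy G u v ∨ IsHeavy G u w ∨ IsHeavy G v w := by
  by_contra hcon
  simp only [IsHeavy, huv, huw, hvw, true_and, not_or, not_le] at hcon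
  obtain ⟨c1, c2, c3⟩ := hcon
  have hcard : #({u, v, w} : Finset V) = 3 := card_eq_three.2
    ⟨u, v, w, huv.ne, huw.ne, hvw.ne, rfl⟩
  have h1 := adjPairs_sdiff G (subset_univ {u, v, w})
  have h2 := hF.adjPairs_le (univ \ {u, v, w})
  have h3 := adjPairs_self_le (G := G) {u, v, w}
  have h4 : adjPairs G (univ \ {u, v, w}) {u, v, w} ≤ #(univ \ {u, v, w}) + 6 := by
    have hz : ∀ z, (∑ y ∈ {u, v, w}, if G.Adj z y then 1 else 0) ≤
        1 + ((if G.Adj u z ∧ G.Adj v z then 1 else 0) + (if G.Adj u z ∧ G.Adj w z then 1 else 0) +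
          (if G.Adj v z ∧ G.Adj w z then 1 else 0)) := by
      intro z
      rw [sum_insert (by simp [huv.ne, huw.ne]), sum_pair hvw.ne]
      simp only [G.adj_comm z]
      by_cases a1 : G.Adj u z <;> by_cases a2 : G.Adj v z <;> by_cases a3 : G.Adj w z <;>
        simp [a1, a2, a3]
    refine (sum_le_sum fun z _ => hz z).trans ?_
    rw [sum_add_distrib, ← card_eq_sum_ones]
    refine Nat.add_le_add_left ((sum_le_sum_of_subset (subset_univ _)).trans ?_) _
    rw [sum_add_distrib, sum_add_distrib, ← card_filter, ← card_filter, ← card_filter]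
    omega
  rw [hcard] at h3
  rw [card_sdiff_univ, hcard] at h2 h4
  obtain ⟨m, hm⟩ : ∃ m, Fintype.card V = m + 3 := ⟨Fintype.card V - 3, by omega⟩
  rw [hm, turanTwo_add_two, turanTwo_succ] at hD
  rw [hm, Nat.add_sub_cancel] at h2 h4
  omega

variable (G) in
/-- A triangle with a heavy edge. -/
def IsHeavyTriangle (S : Finset V) : Prop :=
  ∃ u v w, S = {u, v, w} ∧ IsHeavy G u v ∧ G.Adj u w ∧ G.Adj v w

theorem IsHeavyTriangle.card_eq {S : Finset V} (h : IsHeavyTriangle G S) : #S = 3 := by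
  obtain ⟨u, v, w, rfl, h1, h2, h3⟩ := h
  exact card_eq_three.2 ⟨u, v, w, h1.1.ne, h2.ne, h3.ne, rfl⟩

theorem IsHeavyTriangle.spansTriangle {S : Finset V} (h : IsHeavyTriangle G S) {z : V}
    (hz : z ∈ S) : SpansTriangle G z S := by
  obtain ⟨u, v, w, rfl, h1, h2, h3⟩ := h
  simp only [mem_insert, mem_singleton] at hz
  rcases hz with rfl | rfl | rfl
  · exact ⟨v, by simp, w, by simp, h1.1, h2, h3⟩
  · exact ⟨u, by simp, w, by simp, h1.1.symm, h3, h2⟩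
  · exact ⟨u, by simp, v, by simp, h2.symm, h3.symm, h1.1⟩

/-- An outside vertex adjacent to `w` and to an end of the heavy edge `uv` would give a triangle at
that end missing `uv`. So only `u` and `v` can be two neighbors. -/
theorem FanFree.card_adj_heavyTriangle (hF : FanFree G) {S : Finset V} (hS : IsHeavyTriangle G S)
    {z : V} (hz : z ∉ S) :
    #{y ∈ S | G.Adj z y} ≤ 1 ∨ #{y ∈ S | G.Adj z y} ≤ 2 ∧ SpansTriangle G z S := by
  obtain ⟨u, v, w, rfl, h1, h2, h3⟩ := hS
  simp only [mem_insert, mem_singleton, not_or] at hz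
  have a1 : ¬ (G.Adj z u ∧ G.Adj z w) := fun h => by
    rcases hF.eq_or_eq_of_isHeavy h1 h2 h.1.symm h.2.symm with h | h
    exacts [h3.ne h.symm, hz.2.1 h]
  have a2 : ¬ (G.Adj z v ∧ G.Adj z w) := fun h => by
    rcases hF.eq_or_eq_of_isHeavy h1.symm h3 h.1.symm h.2.symm with h | h
    exacts [h2.ne h.symm, hz.1 h]
  rw [card_filter, sum_insert (by simp [h1.1.ne, h2.ne]), sum_pair h3.ne]
  by_cases b1 : G.Adj z u <;> by_cases b2 : G.Adj z v <;> by_cases b3 : G.Adj z w <;>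
    simp_all
  exact ⟨u, by simp, v, by simp, b1, b2, h1.1⟩

theorem FanFree.exists_heavyTriangle (hF : FanFree G) (hV : 60 ≤ Fintype.card V)
    (hD : 2 * turanTwo (Fintype.card V) < adjPairs G univ univ) {u v w : V}
    (huv : G.Adj u v) (huw : G.Adj u w) (hvw : G.Adj v w) : IsHeavyTriangle G {u, v, w} := by
  rcases hF.exists_isHeavy hV hD huv huw hvw with h | h | h
  · exact ⟨u, v, w, rfl, h, huw, hvw⟩
  · exact ⟨u, w, v, by rw [pair_comm], h, huv, hvw.symm⟩
  · exact ⟨v, w, u, by grind, h, huv.symm, huw.symm⟩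

/-- An outside vertex cannot span triangles with two disjoint sets, so it sends at most 3 edges to
two disjoint heavy triangles and 4 to three. If a third triangle is disjoint from both, deleting all
nine vertices loses too few edges; otherwise Mantel's sharp bound applies to the rest. -/
theorem FanFree.not_disjoint_heavyTriangle (hF : FanFree G) (hV : 200 ≤ Fintype.card V)
    (hD : 2 * turanTwo (Fintype.card V) < adjPairs G univ univ) {S T : Finset V}
    (hS : IsHeavyTriangle G S) (hT : IsHeavyTriangle G T) : ¬ Disjoint S T := by
  intro hST
  have hcU : #(S ∪ T) = 6 := by rw [card_union_of_disjoint hST, hS.card_eq, hT.card_eq]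
  by_cases htri : ∃ x ∈ univ \ (S ∪ T), ∃ y ∈ univ \ (S ∪ T), ∃ z ∈ univ \ (S ∪ T),
      G.Adj x y ∧ G.Adj y z ∧ G.Adj z x
  · obtain ⟨x, hx, y, hy, z, hz, hxy, hyz, hzx⟩ := htri
    have hR := hF.exists_heavyTriangle (by omega) hD hxy hzx.symm hyz
    set R : Finset V := {x, y, z}
    have hRd : Disjoint (S ∪ T) R := by
      rw [Finset.disjoint_right]
      intro a ha
      simp only [R, mem_insert, mem_singleton] at ha
      rcases ha with rfl | rfl | rfl
      exacts [(mem_sdiff.1 hx).2, (mem_sdiff.1 hy).2, (mem_sdiff.1 hz).2]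
    have hSR : Disjoint S R := hRd.mono_left subset_union_left
    have hTR : Disjoint T R := hRd.mono_left subset_union_right
    have hc9 : #(S ∪ T ∪ R) = 9 := by rw [card_union_of_disjoint hRd, hcU, hR.card_eq]
    have h := adjPairs_le_of_card_le (G := G) (subset_univ (S ∪ T ∪ R)) (k := 4) (d := 81) ?_
      ((adjPairs_self_le _).trans (by rw [hc9]))
    · have h2 := hF.adjPairs_le (univ \ (S ∪ T ∪ R))
      rw [card_sdiff_univ, hc9] at h h2
      obtain ⟨m, hm⟩ : ∃ m, Fintype.card V = m + 9 := ⟨Fintype.card V - 9, by omega⟩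
      rw [hm, turanTwo_add_two, turanTwo_add_two, turanTwo_add_two, turanTwo_add_two,
        turanTwo_succ] at hD
      rw [hm, Nat.add_sub_cancel] at h h2
      omega
    · intro a ha
      simp only [mem_sdiff, mem_univ, true_and, mem_union, not_or] at ha
      have g1 := card_filter_union_le (G := G) (S ∪ T) R a
      have g2 := card_filter_union_le (G := G) S T a
      rcases hF.card_adj_heavyTriangle hS ha.1.1 with i1 | ⟨i1, j1⟩ <;>
      rcases hF.card_adj_heavyTriangle hT ha.1.2 with i2 | ⟨i2, j2⟩ <;>
      rcases hF.card_adj_heavyTriangle hR ha.2 with i3 | ⟨i3, j3⟩ <;> try omega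
      · exact absurd j3 (hF.not_spansTriangle hTR j2)
      · exact absurd j3 (hF.not_spansTriangle hSR j1)
      · exact absurd j2 (hF.not_spansTriangle hST j1)
      · exact absurd j2 (hF.not_spansTriangle hST j1)
  · push Not at htri
    have h2 := adjPairs_le_of_triangleFree (G := G) _ htri
    -- No slack here: 2 · `turanTwo (m + 6)` = 2 · `turanTwo m` + 6m + 18. Inside, 18 = 6 + 6 + 2 ·
    -- 3, each vertex of `T` having at most one neighbor in `S`.
    have h := adjPairs_le_of_card_le (G := G) (subset_univ (S ∪ T)) (k := 3) (d := 18) ?_ ?_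
    · rw [card_sdiff_univ, hcU] at h h2
      obtain ⟨m, hm⟩ : ∃ m, Fintype.card V = m + 6 := ⟨Fintype.card V - 6, by omega⟩
      rw [hm, turanTwo_add_two, turanTwo_add_two, turanTwo_add_two] at hD
      rw [hm, Nat.add_sub_cancel] at h h2
      omega
    · intro a ha
      simp only [mem_sdiff, mem_univ, true_and, mem_union, not_or] at ha
      have g2 := card_filter_union_le (G := G) S T a
      rcases hF.card_adj_heavyTriangle hS ha.1 with i1 | ⟨i1, j1⟩ <;>
      rcases hF.card_adj_heavyTriangle hT ha.2 with i2 | ⟨i2, j2⟩ <;> try omega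
      exact absurd j2 (hF.not_spansTriangle hST j1)
    · have hTs : (S ∪ T) \ S = T := by
        rw [union_sdiff_left, sdiff_eq_self_of_disjoint hST.symm]
      have h := adjPairs_le_of_card_le (G := G) (S := S) (U := S ∪ T) subset_union_left (k := 1)
        (d := 6) ?_ ((adjPairs_self_le' _).trans (by rw [hS.card_eq]))
      · have := adjPairs_self_le' (G := G) T
        rw [hTs, hT.card_eq] at h
        rw [hT.card_eq] at this
        omega
      · intro z hz
        rw [hTs] at hz
        rcases hF.card_adj_heavyTriangle hS (Finset.disjoint_right.1 hST hz) with i1 | ⟨i1, j1⟩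
        · exact i1
        · exact absurd (hT.spansTriangle hz) (hF.not_spansTriangle hST j1)

theorem FanFree.not_disjoint_triangle (hF : FanFree G) (hV : 200 ≤ Fintype.card V)
    (hD : 2 * turanTwo (Fintype.card V) < adjPairs G univ univ) {a b c x y z : V}
    (hab : G.Adj a b) (hac : G.Adj a c) (hbc : G.Adj b c) (hxy : G.Adj x y) (hxz : G.Adj x z)
    (hyz : G.Adj y z) : ¬ Disjoint ({a, b, c} : Finset V) {x, y, z} :=
  hF.not_disjoint_heavyTriangle hV hD (hF.exists_heavyTriangle (by omega) hD hab hac hbc)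
    (hF.exists_heavyTriangle (by omega) hD hxy hxz hyz)

/-- With a common neighbor `w` of `u` and `v`, a 4-cycle `u v x y` yields a 5-cycle `u y x v w`. No
outside vertex sees two consecutive vertices of it, hence it sees at most two, and deleting the five
loses too few edges. -/
theorem FanFree.cyclePairs_eq_empty (hF : FanFree G) (hV : 200 ≤ Fintype.card V)
    (hD : 2 * turanTwo (Fintype.card V) < adjPairs G univ univ) {u v : V} (h : IsHeavy G u v) :
    cyclePairs G u v = ∅ := by
  rw [eq_empty_iff_forall_notMem]
  rintro ⟨x, y⟩ hxy
  simp only [cyclePairs, mem_filter, mem_univ, true_and] at hxy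
  obtain ⟨hvx, hxy, hyu, hxu, hyv⟩ := hxy
  have hux : ¬ G.Adj u x := fun hux => by
    rcases hF.eq_or_eq_of_isHeavy h hux hyu.symm hxy with h | h
    exacts [hvx.ne h.symm, hyv h]
  have hvy : ¬ G.Adj v y := fun hvy => by
    rcases hF.eq_or_eq_of_isHeavy h.symm hvx hvy hxy with h | h
    exacts [hxu h, hyu.ne h]
  obtain ⟨w, huw, hvw, hwx, hwy⟩ := h.exists_common x y
  have e1 := h.1.ne
  have e2 := hvx.ne
  have e3 := hyu.ne
  have e4 := hxy.ne
  have e5 := huw.ne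
  have e6 := hvw.ne
  have hcard : #({u, y, x, v, w} : Finset V) = 5 := by
    rw [card_insert_of_notMem (by simp [e3.symm, hxu.symm, e1, e5]),
      card_insert_of_notMem (by simp [e4.symm, hyv, hwy.symm]),
      card_insert_of_notMem (by simp [e2.symm, hwx.symm]), card_pair e6]
  have hle := adjPairs_le_of_card_le (G := G) (subset_univ {u, y, x, v, w}) (k := 2) (d := 25) ?_
      ((adjPairs_self_le _).trans (by rw [hcard]))
  · have h2 := hF.adjPairs_le (univ \ {u, y, x, v, w})
    rw [card_sdiff_univ, hcard] at hle h2
    obtain ⟨m, hm⟩ : ∃ m, Fintype.card V = m + 5 := ⟨Fintype.card V - 5, by omega⟩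
    rw [hm, turanTwo_add_two, turanTwo_add_two, turanTwo_succ] at hD
    rw [hm, Nat.add_sub_cancel] at hle h2
    omega
  · intro z hz
    simp only [mem_sdiff, mem_univ, true_and, mem_insert, mem_singleton, not_or] at hz
    obtain ⟨zu, zy, zx, zv, zw⟩ := hz
    have a1 : ¬ (G.Adj z u ∧ G.Adj z y) := fun hz => by
      rcases hF.eq_or_eq_of_isHeavy h hz.1.symm hyu.symm hz.2 with h | h
      exacts [zv h, hyv h]
    have a2 : ¬ (G.Adj z v ∧ G.Adj z x) := fun hz => by
      rcases hF.eq_or_eq_of_isHeavy h.symm hz.1.symm hvx hz.2 with h | h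
      exacts [zu h, hxu h]
    have a3 : ¬ (G.Adj z u ∧ G.Adj z w) := fun hz => by
      rcases hF.eq_or_eq_of_isHeavy h hz.1.symm huw hz.2 with h | h
      exacts [zv h, e6 h.symm]
    have a4 : ¬ (G.Adj z v ∧ G.Adj z w) := fun hz => by
      rcases hF.eq_or_eq_of_isHeavy h.symm hz.1.symm hvw hz.2 with h | h
      exacts [zu h, e5 h.symm]
    have a5 : ¬ (G.Adj z x ∧ G.Adj z y) := fun hz => by
      refine hF.not_disjoint_triangle hV hD h.1 huw hvw hxy hz.1.symm hz.2.symm ?_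
      simp only [disjoint_insert_right, disjoint_singleton_right, mem_insert, mem_singleton, not_or]
      exact ⟨⟨hxu, e2.symm, hwx.symm⟩, ⟨e3, hyv, hwy.symm⟩, zu, zv, zw⟩
    rw [card_filter, sum_insert (by simp [e3.symm, hxu.symm, e1, e5]),
      sum_insert (by simp [e4.symm, hyv, hwy.symm]),
      sum_insert (by simp [e2.symm, hwx.symm]), sum_pair e6]
    by_cases b1 : G.Adj z u <;> by_cases b2 : G.Adj z v <;> by_cases b3 : G.Adj z w <;>
      by_cases b4 : G.Adj z x <;> by_cases b5 : G.Adj z y <;> simp_all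

/-- A large `F₂`-free graph with more edges than the Turán graph has exactly one edge more, and
one of its edges lies in no 4-cycle. -/
theorem FanFree.exists_cyclePairs_eq_empty (hF : FanFree G) (hV : 200 ≤ Fintype.card V)
    (hD : 2 * turanTwo (Fintype.card V) < adjPairs G univ univ) :
    adjPairs G univ univ ≤ 2 * turanTwo (Fintype.card V) + 2 ∧
      ∃ u v, G.Adj u v ∧ cyclePairs G u v = ∅ := by
  by_cases htri : ∃ x ∈ univ, ∃ y ∈ univ, ∃ z ∈ univ, G.Adj x y ∧ G.Adj y z ∧ G.Adj z x
  swap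
  · push Not at htri
    have h2 := adjPairs_le_of_triangleFree (G := G) _ htri
    rw [card_univ] at h2
    omega
  obtain ⟨x, -, y, -, z, -, hxy, hyz, hzx⟩ := htri
  obtain ⟨u, v, huv⟩ : ∃ u v, IsHeavy G u v := by
    rcases hF.exists_isHeavy (by omega) hD hxy hzx.symm hyz with h | h | h
    exacts [⟨_, _, h⟩, ⟨_, _, h⟩, ⟨_, _, h⟩]
  refine ⟨?_, u, v, huv.1, hF.cyclePairs_eq_empty hV hD huv⟩
  have hmem : ∀ {u v}, IsHeavy G u v → ∀ {b c}, G.Adj u b → G.Adj u c → G.Adj b c →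
      b = v ∨ c = v := fun h _ _ h1 h2 h3 => hF.eq_or_eq_of_isHeavy h h1 h2 h3
  -- A triangle missing `uv` avoids both its ends, yet meets every triangle on `uv`. Two common
  -- neighbors of `u` and `v` are then vertices of it, giving a triangle at `u` without `v`.
  have h0 : ∀ a b c, G.Adj a b → G.Adj b c → G.Adj c a →
      ¬ (s(a, b) ≠ s(u, v) ∧ s(b, c) ≠ s(u, v) ∧ s(c, a) ≠ s(u, v)) := by
    intro a b c hab hbc hca hne
    have n1 := hab.ne
    have n2 := hbc.ne
    have n3 := hca.ne
    have hu : u ≠ a ∧ u ≠ b ∧ u ≠ c := by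
      refine ⟨?_, ?_, ?_⟩ <;> rintro rfl
      · rcases hmem huv hab hca.symm hbc with rfl | rfl <;> simp at hne
      · rcases hmem huv hbc hab.symm hca with rfl | rfl <;> simp at hne
      · rcases hmem huv hca hbc.symm hab with rfl | rfl <;> simp at hne
    have hv : v ≠ a ∧ v ≠ b ∧ v ≠ c := by
      refine ⟨?_, ?_, ?_⟩ <;> rintro rfl
      · rcases hmem huv.symm hab hca.symm hbc with rfl | rfl <;> simp at hu
      · rcases hmem huv.symm hbc hab.symm hca with rfl | rfl <;> simp at hu
      · rcases hmem huv.symm hca hbc.symm hab with rfl | rfl <;> simp at hu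
    have hdis : ∀ w, G.Adj u w → G.Adj v w → w = a ∨ w = b ∨ w = c := by
      intro w h1 h2
      by_contra hw
      simp only [not_or] at hw
      refine hF.not_disjoint_triangle hV hD huv.1 h1 h2 hab hca.symm hbc ?_
      simp only [disjoint_insert_left, disjoint_singleton_left, mem_insert, mem_singleton, not_or]
      exact ⟨hu, hv, hw⟩
    obtain ⟨w, h1, h2, hwa, hwb⟩ := huv.exists_common a b
    obtain ⟨w', h1', h2', hwa', hwc'⟩ := huv.exists_common a c
    have hw : w = c := by simpa [hwa, hwb] using hdis w h1 h2
    have hw' : w' = b := by simpa [hwa', hwc'] using hdis w' h1' h2'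
    subst hw hw'
    rcases hmem huv h1 h1' hbc.symm with h | h
    exacts [hv.2.2 h.symm, hv.2.1 h.symm]
  have hmantel := adjPairs_le_of_triangleFree (G := G.deleteEdges {s(u, v)}) univ (by
    intro a _ b _ c _ hab hbc hca
    rw [deleteEdges_adj] at hab hbc hca
    exact h0 a b c hab.1 hbc.1 hca.1 ⟨hab.2, hbc.2, hca.2⟩)
  have hsplit := adjPairs_le_deleteEdges_add_two G u v
  rw [card_univ] at hmantel
  omega

end

/-! ### Upper bounds for 4-cycles and edges. -/

theorem FanFree.mono {V : Type*} {G G' : SimpleGraph V} (h : FanFree G) (hle : G' ≤ G) :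
    FanFree G' := fun c a b d e h1 h2 h3 h4 h5 h6 =>
  h c a b d e (hle h1) (hle h2) (hle h3) (hle h4) (hle h5) (hle h6)

section

variable {V : Type*} [Fintype V] [DecidableEq V] {G : SimpleGraph V} [DecidableRel G.Adj]

theorem FanFree.eight_mul_copyCount_le (hF : FanFree G) (hV : 6 ≤ Fintype.card V) :
    8 * G.copyCount (cycleGraph 4) ≤
      adjPairs G univ univ * turanTwo (Fintype.card V - 2) := by
  rw [eight_mul_copyCount_cycleGraph_four, adjPairs, sum_mul]
  refine sum_le_sum fun u _ => ?_
  rw [sum_mul]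
  refine sum_le_sum fun v _ => ?_
  split_ifs with h
  · rw [one_mul]
    exact hF.card_cyclePairs_le hV h
  · simp

/-- The upper bound for the number of 4-cycles of a large `F₂`-free graph. -/
theorem FanFree.four_mul_copyCount_le (hF : FanFree G) (hV : 200 ≤ Fintype.card V) :
    4 * G.copyCount (cycleGraph 4) ≤
      turanTwo (Fintype.card V) * turanTwo (Fintype.card V - 2) := by
  have h8 := hF.eight_mul_copyCount_le (by omega)
  set M := turanTwo (Fintype.card V - 2)
  by_cases hD : adjPairs G univ univ ≤ 2 * turanTwo (Fintype.card V)
  · have := Nat.mul_le_mul_right M hD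
    rw [mul_assoc] at this
    omega
  obtain ⟨h2, u, v, huv, hc⟩ := hF.exists_cyclePairs_eq_empty hV (not_le.1 hD)
  have hc' : #(cyclePairs G v u) = 0 := by rw [card_cyclePairs_comm, hc, card_empty]
  -- Both orientations of `uv` contribute nothing, saving `2 * M`: exactly the gain from one surplus
  -- edge.
  have key : 8 * G.copyCount (cycleGraph 4) + 2 * M ≤ adjPairs G univ univ * M := by
    have h1 : ∑ a : V, ∑ b : V, ((if a = u then if b = v then M else 0 else 0) +
        (if a = v then if b = u then M else 0 else 0)) = 2 * M := by
      simp only [sum_add_distrib]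
      simp [two_mul]
    rw [eight_mul_copyCount_cycleGraph_four, ← h1, ← sum_add_distrib, adjPairs, sum_mul]
    refine sum_le_sum fun a _ => ?_
    rw [sum_mul, ← sum_add_distrib]
    refine sum_le_sum fun b _ => ?_
    have hne := huv.ne
    by_cases e1 : a = u ∧ b = v
    · obtain ⟨rfl, rfl⟩ := e1
      simp [huv, hc, hne]
    by_cases e2 : a = v ∧ b = u
    · obtain ⟨rfl, rfl⟩ := e2
      simp [huv.symm, hc', hne.symm]
    have h3 : (if a = u then if b = v then M else 0 else 0) = 0 := by grind
    have h4 : (if a = v then if b = u then M else 0 else 0) = 0 := by grind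
    rw [h3, h4]
    split_ifs with h
    · simpa using hF.card_cyclePairs_le (by omega) h
    · simp
  have := Nat.mul_le_mul_right M h2
  rw [add_mul, mul_assoc] at this
  omega

theorem FanFree.copyCount_completeGraph_two_le (hF : FanFree G) (hV : 200 ≤ Fintype.card V) :
    G.copyCount (completeGraph (Fin 2)) ≤ turanTwo (Fintype.card V) + 1 := by
  have h := two_mul_copyCount_completeGraph_two G
  by_cases hD : adjPairs G univ univ ≤ 2 * turanTwo (Fintype.card V)
  · omega
  · have := (hF.exists_cyclePairs_eq_empty hV (not_le.1 hD)).1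
    omega

end

/-! ### The colored upper bound. -/

theorem adjPairs_labelGraph {V : Type*} [Fintype V] {G : SimpleGraph V} [DecidableRel G.Adj]
    (C : G.EdgeLabeling (Fin 2)) : adjPairs G univ univ =
      adjPairs (C.labelGraph 0) univ univ + adjPairs (C.labelGraph 1) univ univ := by
  unfold adjPairs
  rw [← sum_add_distrib]
  refine Finset.sum_congr rfl fun x _ => ?_
  rw [← sum_add_distrib]
  refine Finset.sum_congr rfl fun y _ => ?_
  by_cases h : G.Adj x y
  · have : C ⟨s(x, y), h⟩ = 0 ∨ C ⟨s(x, y), h⟩ = 1 := by omega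
    rcases this with h1 | h1 <;> simp [EdgeLabeling.labelGraph_adj, h, h1]
  · simp [EdgeLabeling.labelGraph_adj, h]

theorem colCount_eq {V : Type*} [Fintype V] {G : SimpleGraph V} (C : G.EdgeLabeling (Fin 2)) :
    colCount ![⟨4, cycleGraph 4⟩, ⟨2, completeGraph (Fin 2)⟩] C =
      (C.labelGraph 0).copyCount (cycleGraph 4) +
        (C.labelGraph 1).copyCount (completeGraph (Fin 2)) := by
  rw [colCount, Fin.sum_univ_two]
  rfl

theorem eight_le_turanTwo {n : ℕ} (hn : 6 ≤ n) : 8 ≤ turanTwo n :=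
  calc 8 ≤ 3 * 3 := by norm_num
    _ ≤ turanTwo n := mul_le_turanTwo (by omega)

/-- The upper bound for colored `F₂`-free graphs. -/
theorem FanFree.four_mul_colCount_le {V : Type*} [Fintype V] {G : SimpleGraph V}
    (hF : FanFree G) (hV : 200 ≤ Fintype.card V) (C : G.EdgeLabeling (Fin 2)) :
    4 * colCount ![⟨4, cycleGraph 4⟩, ⟨2, completeGraph (Fin 2)⟩] C ≤
      turanTwo (Fintype.card V) * turanTwo (Fintype.card V - 2) + 4 := by
  classical
  rw [colCount_eq]
  have hR : FanFree (C.labelGraph 0) := hF.mono C.labelGraph_le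
  have h1 := hR.eight_mul_copyCount_le (by omega)
  have h2 := two_mul_copyCount_completeGraph_two (C.labelGraph 1)
  have h3 := adjPairs_labelGraph C
  have hM : 8 ≤ turanTwo (Fintype.card V - 2) := eight_le_turanTwo (by omega)
  have hmono := hR.four_mul_copyCount_le hV
  set M := turanTwo (Fintype.card V - 2)
  set q := turanTwo (Fintype.card V)
  rcases Nat.eq_zero_or_pos ((C.labelGraph 1).copyCount (completeGraph (Fin 2))) with h0 | h0
  · omega
  have hD : adjPairs G univ univ ≤ 2 * q + 2 := by
    by_cases hD : adjPairs G univ univ ≤ 2 * q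
    · omega
    · exact (hF.exists_cyclePairs_eq_empty hV (not_le.1 hD)).1
  set N₁ := (C.labelGraph 0).copyCount (cycleGraph 4)
  set N₂ := (C.labelGraph 1).copyCount (completeGraph (Fin 2))
  -- One edge of color 1 absorbs the possible surplus edge; each of the other `k` costs `M` in `4 *
  -- N₁` and gains only 4.
  obtain ⟨k, hk⟩ : ∃ k, N₂ = k + 1 := ⟨N₂ - 1, by omega⟩
  have h4 : adjPairs (C.labelGraph 0) univ univ + 2 * k ≤ 2 * q := by omega
  have h5 := Nat.mul_le_mul_right M h4
  rw [hk]
  nlinarith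

/-! ### The extremal construction. -/

/-- The balanced complete bipartite graph. -/
def balancedBipartite (n : ℕ) : SimpleGraph (Fin n) where
  Adj i j := ¬ (i.val < n / 2 ↔ j.val < n / 2)
  symm := ⟨fun _ _ h h' => h h'.symm⟩
  loopless := ⟨fun _ h => h Iff.rfl⟩

instance (n : ℕ) : DecidableRel (balancedBipartite n).Adj :=
  fun i j => inferInstanceAs (Decidable (¬ (i.val < n / 2 ↔ j.val < n / 2)))

/-- The balanced complete bipartite graph with the edge `01` added. -/
def balancedBipartiteAddEdge (n : ℕ) : SimpleGraph (Fin n) where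
  Adj i j := (balancedBipartite n).Adj i j ∨ i ≠ j ∧ i.val < 2 ∧ j.val < 2
  symm := ⟨fun _ _ h => h.imp (fun h => h.symm) fun h => ⟨h.1.symm, h.2.2, h.2.1⟩⟩
  loopless := ⟨fun i h => h.elim (fun h => (balancedBipartite n).loopless.irrefl i h)
    fun h => h.1 rfl⟩

theorem balancedBipartite_le (n : ℕ) : balancedBipartite n ≤ balancedBipartiteAddEdge n :=
  fun _ _ h => .inl h

/-- Every triangle uses the edge `01`, so any two triangles share two vertices. -/
theorem fanFree_balancedBipartiteAddEdge (n : ℕ) : FanFree (balancedBipartiteAddEdge n) := by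
  have key : ∀ x y z, (balancedBipartiteAddEdge n).Adj x y → (balancedBipartiteAddEdge n).Adj x z →
      (balancedBipartiteAddEdge n).Adj y z → x.val < 2 ∧ y.val < 2 ∨ x.val < 2 ∧ z.val < 2 ∨
        y.val < 2 ∧ z.val < 2 := by
    intro x y z h1 h2 h3
    simp only [balancedBipartiteAddEdge, balancedBipartite] at h1 h2 h3
    tauto
  intro c a b d e h1 h2 h3 h4 h5 h6
  have k1 := key _ _ _ h1 h2 h3
  have k2 := key _ _ _ h4 h5 h6
  have n1 := h1.ne
  have n2 := h2.ne
  have n3 := h3.ne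
  have n4 := h4.ne
  have n5 := h5.ne
  have n6 := h6.ne
  simp only [Fin.ext_iff, ne_eq] at *
  omega

theorem card_val_lt_half (n : ℕ) : #{i : Fin n | i.val < n / 2} = n / 2 := by
  rw [Fin.card_filter_val_lt]
  omega

theorem card_not_val_lt_half (n : ℕ) : #{i : Fin n | ¬ i.val < n / 2} = (n + 1) / 2 := by
  have h := card_filter_add_card_filter_not (s := (univ : Finset (Fin n))) (fun i => i.val < n / 2)
  rw [card_val_lt_half, card_univ, Fintype.card_fin] at h
  omega

theorem adjPairs_balancedBipartite (n : ℕ) :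
    adjPairs (balancedBipartite n) univ univ = 2 * turanTwo n := by
  rw [adjPairs_eq_sum_card, ← sum_filter_add_sum_filter_not univ (fun i : Fin n => i.val < n / 2)]
  have h1 : ∀ i ∈ ({i : Fin n | i.val < n / 2} : Finset _),
      #{j | (balancedBipartite n).Adj i j} = (n + 1) / 2 := by
    intro i hi
    rw [mem_filter] at hi
    rw [← card_not_val_lt_half]
    congr 1
    ext j
    simp [balancedBipartite, hi.2]
  have h2 : ∀ i ∈ ({i : Fin n | ¬ i.val < n / 2} : Finset _),
      #{j | (balancedBipartite n).Adj i j} = n / 2 := by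
    intro i hi
    rw [mem_filter] at hi
    conv_rhs => rw [← card_val_lt_half]
    congr 1
    ext j
    rw [mem_filter, mem_filter]
    simp only [balancedBipartite, mem_univ, true_and]
    tauto
  rw [Finset.sum_congr rfl h1, Finset.sum_congr rfl h2]
  simp only [sum_const, card_val_lt_half, card_not_val_lt_half, turanTwo, smul_eq_mul]
  ring

theorem card_cyclePairs_balancedBipartite {n : ℕ} {u v : Fin n}
    (h : (balancedBipartite n).Adj u v) :
    #(cyclePairs (balancedBipartite n) u v) = turanTwo (n - 2) := by
  wlog hu : u.val < n / 2 generalizing u v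
  · rw [card_cyclePairs_comm]
    exact this h.symm (by simp only [balancedBipartite] at h; tauto)
  have hv : ¬ v.val < n / 2 := by simp only [balancedBipartite] at h; tauto
  have e : cyclePairs (balancedBipartite n) u v =
      ({i : Fin n | i.val < n / 2} : Finset _).erase u ×ˢ
        ({i : Fin n | ¬ i.val < n / 2} : Finset _).erase v := by
    ext ⟨x, y⟩
    rw [cyclePairs, mem_filter]
    simp only [balancedBipartite, mem_filter, mem_univ, true_and, mem_product, mem_erase]
    tauto
  rw [e, card_product, card_erase_of_mem (by simpa using hu), card_erase_of_mem (by simpa using hv),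
    card_val_lt_half, card_not_val_lt_half, turanTwo]
  congr 1 <;> omega

theorem four_mul_copyCount_balancedBipartite (n : ℕ) :
    4 * (balancedBipartite n).copyCount (cycleGraph 4) = turanTwo n * turanTwo (n - 2) := by
  have h := eight_mul_copyCount_cycleGraph_four (balancedBipartite n)
  have h2 : (∑ u, ∑ v, if (balancedBipartite n).Adj u v then
      #(cyclePairs (balancedBipartite n) u v) else 0) =
        adjPairs (balancedBipartite n) univ univ * turanTwo (n - 2) := by
    rw [adjPairs, sum_mul]
    refine Finset.sum_congr rfl fun u _ => ?_
    rw [sum_mul]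
    refine Finset.sum_congr rfl fun v _ => ?_
    split_ifs with h
    · rw [card_cyclePairs_balancedBipartite h, one_mul]
    · simp
  rw [h2, adjPairs_balancedBipartite, mul_assoc] at h
  omega

open scoped Classical in
/-- The coloring of the bipartite edges by `0` and of the additional edge by `1`. -/
noncomputable def bipartiteLabeling (n : ℕ) : (balancedBipartiteAddEdge n).EdgeLabeling (Fin 2) :=
  fun e => if e.1 ∈ (balancedBipartite n).edgeSet then 0 else 1

theorem four_mul_colCount_bipartiteLabeling {n : ℕ} (hn : 4 ≤ n) :
    turanTwo n * turanTwo (n - 2) + 4 ≤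
      4 * colCount ![⟨4, cycleGraph 4⟩, ⟨2, completeGraph (Fin 2)⟩] (bipartiteLabeling n) := by
  classical
  have h0 : (bipartiteLabeling n).labelGraph 0 = balancedBipartite n := by
    ext x y
    rw [EdgeLabeling.labelGraph_adj]
    simp only [bipartiteLabeling, mem_edgeSet, ite_eq_left_iff, one_ne_zero, imp_false, not_not,
      exists_prop, and_iff_right_iff_imp]
    exact fun h => balancedBipartite_le n h
  have h1 : ((bipartiteLabeling n).labelGraph 1).Adj ⟨0, by omega⟩ ⟨1, by omega⟩ := by
    rw [EdgeLabeling.labelGraph_adj]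
    refine ⟨.inr (by simp), if_neg ?_⟩
    simp only [mem_edgeSet, balancedBipartite, not_not]
    omega
  have h2 : 0 < ((bipartiteLabeling n).labelGraph 1).copyCount (completeGraph (Fin 2)) := by
    have h := two_mul_copyCount_completeGraph_two ((bipartiteLabeling n).labelGraph 1)
    have : 0 < adjPairs ((bipartiteLabeling n).labelGraph 1) univ univ :=
      sum_pos' (fun _ _ => Nat.zero_le _) ⟨_, mem_univ _,
        sum_pos' (fun _ _ => Nat.zero_le _) ⟨_, mem_univ _, by rw [if_pos h1]; exact one_pos⟩⟩
    omega
  rw [colCount_eq, h0, mul_add, four_mul_copyCount_balancedBipartite]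
  omega

/-! ### The extremal values. -/

theorem four_mul_genEx_cycleGraph_four {n : ℕ} (hn : 200 ≤ n) :
    4 * genEx n (cycleGraph 4) twoFan = turanTwo n * turanTwo (n - 2) := by
  classical
  have hle : genEx n (cycleGraph 4) twoFan ≤ turanTwo n * turanTwo (n - 2) / 4 := by
    refine Finset.sup_le fun G hG => ?_
    have h := (FanFree.of_free (mem_filter.1 hG).2).four_mul_copyCount_le (by simpa using hn)
    rw [Fintype.card_fin] at h
    omega
  have hge : (balancedBipartite n).copyCount (cycleGraph 4) ≤ genEx n (cycleGraph 4) twoFan :=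
    Finset.le_sup (f := fun G : SimpleGraph (Fin n) => G.copyCount (cycleGraph 4))
      (mem_filter.2 ⟨mem_univ _, free_of_fanFree
        ((fanFree_balancedBipartiteAddEdge n).mono (balancedBipartite_le n))⟩)
  have := four_mul_copyCount_balancedBipartite n
  omega

theorem genEx_completeGraph_two_le {n : ℕ} (hn : 200 ≤ n) :
    genEx n (completeGraph (Fin 2)) twoFan ≤ turanTwo n + 1 := by
  classical
  refine Finset.sup_le fun G hG => ?_
  have h := (FanFree.of_free (mem_filter.1 hG).2).copyCount_completeGraph_two_le
    (by simpa using hn)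
  rwa [Fintype.card_fin] at h

theorem four_mul_colEx {n : ℕ} (hn : 200 ≤ n) :
    4 * colEx n ![⟨4, cycleGraph 4⟩, ⟨2, completeGraph (Fin 2)⟩] twoFan =
      turanTwo n * turanTwo (n - 2) + 4 := by
  classical
  have hle : colEx n ![⟨4, cycleGraph 4⟩, ⟨2, completeGraph (Fin 2)⟩] twoFan ≤
      (turanTwo n * turanTwo (n - 2) + 4) / 4 := by
    refine Finset.sup_le fun G hG => Finset.sup_le fun C _ => ?_
    have h := (FanFree.of_free (mem_filter.1 hG).2).four_mul_colCount_le (by simpa using hn) C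
    rw [Fintype.card_fin] at h
    omega
  have hge : colCount ![⟨4, cycleGraph 4⟩, ⟨2, completeGraph (Fin 2)⟩] (bipartiteLabeling n) ≤
      colEx n ![⟨4, cycleGraph 4⟩, ⟨2, completeGraph (Fin 2)⟩] twoFan := by
    refine le_trans ?_ (Finset.le_sup (b := balancedBipartiteAddEdge n)
      (mem_filter.2 ⟨mem_univ _, free_of_fanFree (fanFree_balancedBipartiteAddEdge n)⟩))
    exact Finset.le_sup (f := fun C => colCount _ C) (mem_univ (bipartiteLabeling n))
  have := four_mul_colCount_bipartiteLabeling (n := n) (by omega)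
  omega

theorem floor_half (n : ℕ) : ⌊(n : ℚ) / 2⌋ = ((n / 2 : ℕ) : ℤ) := by
  have := Rat.floor_intCast_div_natCast (n : ℤ) 2
  simpa using this

theorem ceil_half (n : ℕ) : ⌈(n : ℚ) / 2⌉ = (((n + 1) / 2 : ℕ) : ℤ) := by
  rw [Int.ceil_eq_iff]
  obtain ⟨k, rfl | rfl⟩ := n.even_or_odd'
  · have : (2 * k + 1) / 2 = k := by omega
    rw [this]
    push_cast
    constructor <;> linarith
  · have : (2 * k + 1 + 1) / 2 = k + 1 := by omega
    rw [this]
    push_cast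
    constructor <;> linarith

end ColoredTuran

theorem mainTheorem7 :
    ∃ n₀ : ℕ, ∀ n : ℕ, n₀ ≤ n →
      (ColoredTuran.colEx n ![⟨4, SimpleGraph.cycleGraph 4⟩, ⟨2, SimpleGraph.completeGraph (Fin 2)⟩]
          ColoredTuran.twoFan : ℚ) =
        (⌊(n : ℚ) / 2⌋ : ℚ) * (⌈(n : ℚ) / 2⌉ : ℚ) *
          ((⌊(n : ℚ) / 2⌋ : ℚ) - 1) * ((⌈(n : ℚ) / 2⌉ : ℚ) - 1) / 4 + 1 ∧
      ColoredTuran.colEx n ![⟨4, SimpleGraph.cycleGraph 4⟩, ⟨2, SimpleGraph.completeGraph (Fin 2)⟩]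
          ColoredTuran.twoFan =
        max (ColoredTuran.genEx n (SimpleGraph.cycleGraph 4) ColoredTuran.twoFan)
          (ColoredTuran.genEx n (SimpleGraph.completeGraph (Fin 2)) ColoredTuran.twoFan) + 1 := by
  refine ⟨200, fun n hn => ?_⟩
  have h1 := ColoredTuran.four_mul_colEx hn
  have h2 := ColoredTuran.four_mul_genEx_cycleGraph_four hn
  have h3 := ColoredTuran.genEx_completeGraph_two_le hn
  constructor
  · rw [ColoredTuran.floor_half, ColoredTuran.ceil_half]
    have e1 : (n - 2) / 2 = n / 2 - 1 := by omega
    have e2 : (n - 2 + 1) / 2 = (n + 1) / 2 - 1 := by omega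
    have h4 := congrArg (Nat.cast : ℕ → ℚ) h1
    rw [ColoredTuran.turanTwo, ColoredTuran.turanTwo, e1, e2] at h4
    rw [Nat.cast_mul, Nat.cast_add, Nat.cast_mul, Nat.cast_mul, Nat.cast_mul,
      Nat.cast_sub (by omega), Nat.cast_sub (by omega)] at h4
    rw [Int.cast_natCast, Int.cast_natCast]
    simp only [Nat.cast_ofNat, Nat.cast_one] at h4
    linarith
  -- The maximum is the 4-cycle term: qM/4 ≥ 2q ≥ q + 1, and q + 1 bounds the edge term.
  · have hM : 8 ≤ ColoredTuran.turanTwo (n - 2) := ColoredTuran.eight_le_turanTwo (by omega)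
    have hq : 8 ≤ ColoredTuran.turanTwo n := ColoredTuran.eight_le_turanTwo (by omega)
    have h5 : ColoredTuran.turanTwo n * 8 ≤
        ColoredTuran.turanTwo n * ColoredTuran.turanTwo (n - 2) := Nat.mul_le_mul_left _ hM
    rw [max_eq_left (by omega)]
    omega
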